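/- Let $\mathbb{N}^{<\mathbb{N}}$ be the set of finite words over $\mathbb{N}=\{0,1,2,\dots\}$ and give its power set $\mathcal P(\mathbb{N}^{<\mathbb{N}})$ the topology for which the sets $\{T : s\in T\}$, $s\in\mathbb{N}^{<\mathbb{N}}$, together with their complements, form a subbasis. A tree is a set $T\subseteq \mathbb{N}^{<\mathbb{N}}$ closed under initial segments; an infinite branch of $T$ is a $y\in\mathbb{N}^{\mathbb{N}}$ with $y|n=(y_0,\dots,y_{n-1})\in T$ for all $n\in\mathbb{N}$. Let $R$ be the set of pairs $(T,y)$ with $T$ a tree and $y$ an infinite branch of $T$, and let $IF$ be the set of ill-founded trees, i.e. trees that have an infinite branch. Let $(s_i)_{i\in\mathbb{N}}$ be any enumeration without repetition of $\mathbb{N}^{<\mathbb{N}}$. For $T\subseteq\mathbb{N}^{<\mathbb{N}}$ let $h(T)\in\{0,1\}^{\mathbb{N}}$ be given by $h(T)_i=1$ if $s_i\in T$ and $h(T)_i=0$ otherwise. Let $\sigma$ be the shift map $(\sigma z)_i=z_{i+1}$ on $\{0,1,2,3,4\}^{\mathbb{N}}$ (with the product topology). For $(T,y)\in R$ define, writing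 juxtaposition for concatenation, $$\omega_0(T,y)=3\,4\,0^\infty,\qquad \omega_n(T,y)=3\,(h(T)|n)\,2^{\,n+y_{n-1}}\,\omega_{n-1}(T,y)\quad(n\ge 1),$$ and let $$X=\{0,1,2,3\}^{\mathbb{N}}\cup\{\sigma^j(\omega_i(T,y)) : (T,y)\in R,\ i,j\in\mathbb{N}\}.$$ Then $X$ is a subshift (it is closed and $\sigma(X)\subseteq X$), and $\sigma(X)=X$. Moreover, let $\omega_0=3\,4\,0^\infty\in X$, and let $s\alpha(\omega_0)\subseteq X$ be its special $\alpha$-limit set under $\sigma|_X$, that is, the union of the sets of accumulation points of all sequences $(x_n)_{n\in\mathbb{N}}$ in $X$ with $x_0=\omega_0$ and $\sigma(x_{n+1})=x_n$ for all $n$. Then $s\alpha(\omega_0)$ is $\mathbf{\Sigma}^1_1$-complete, i.e. it is an analytic but not a Borel subset of $X$. Furthermore, the map $f:\mathcal P(\mathbb{N}^{<\mathbb{N}})\to X$, $f(T)=3\,h(T)$, is well defined and continuous, and $f^{-1}(s\alpha(\omega_0))=IF$. -/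

import Mathlib

open Set Filter Topology MeasureTheory

namespace SpecialAlpha

/-! ### Special alpha-limit sets and completeness -/

section General

variable {Y : Type*}

/-- `u` is a backward orbit of `x` under `f`: `u 0 = x` and `f (u (n + 1)) = u n` for all `n`. -/
def IsBackwardOrbit (f : Y → Y) (x : Y) (u : ℕ → Y) : Prop :=
  u 0 = x ∧ ∀ n, f (u (n + 1)) = u n

/-- The special alpha-limit set of `x`: the union, over all backward orbits of `x`, of their sets
of accumulation points (cluster points of the sequence). -/
def specialAlphaLimit [TopologicalSpace Y] (f : Y → Y) (x : Y) : Set Y :=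
  ⋃ u ∈ {u : ℕ → Y | IsBackwardOrbit f x u}, {z | MapClusterPt z atTop u}

/-- A subset of a Polish space is `Σ¹₁`-complete if it is analytic but not Borel. -/
def IsSigmaOneOneComplete [TopologicalSpace Y] (s : Set Y) : Prop :=
  AnalyticSet s ∧ ¬ MeasurableSet[borel Y] s

end General

/-! ### Words -/

/-- Concatenation of a finite word with an infinite word. -/
def conc {A : Type*} (l : List A) (z : ℕ → A) : ℕ → A :=
  fun i => if h : i < l.length then l[i] else z (i - l.length)

/-- The initial segment `z|n = (z 0, …, z (n - 1))` of an infinite word. -/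
def initSeg {A : Type*} (z : ℕ → A) (n : ℕ) : List A :=
  (List.range n).map z

/-! ### Trees and the space of sets of words -/

/-- The topology on the power set of the set of finite words over `ℕ` for which the sets
`{T | s ∈ T}` and their complements form a subbasis, i.e. the topology of the Cantor space
of characteristic functions. -/
abbrev powerTopology : TopologicalSpace (Set (List ℕ)) :=
  TopologicalSpace.generateFrom
    ({U | ∃ s : List ℕ, U = {T | s ∈ T}} ∪ {U | ∃ s : List ℕ, U = {T | s ∈ T}ᶜ})

/-- A tree on `ℕ`: a set of finite words closed under taking initial segments. -/
def IsTree (T : Set (List ℕ)) : Prop :=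
  T ∈ Descriptive.tree ℕ

theorem isTree_iff (T : Set (List ℕ)) : IsTree T ↔ ∀ t ∈ T, ∀ s, s <+: t → s ∈ T :=
  ⟨fun h _ ht _ hs => Descriptive.Tree.mem_of_prefix (T := ⟨T, h⟩) hs ht,
    fun h x a hx => h _ hx x ⟨[a], rfl⟩⟩

/-- `y` is an infinite branch of `T`. -/
def IsInfiniteBranch (T : Set (List ℕ)) (y : ℕ → ℕ) : Prop :=
  ∀ n, initSeg y n ∈ T

/-- The set of pairs of an (ill-founded) tree and an infinite branch of it. -/
def branchPairs : Set (Set (List ℕ) × (ℕ → ℕ)) :=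
  {p | IsTree p.1 ∧ IsInfiniteBranch p.1 p.2}

/-- The set of ill-founded trees. -/
def illFounded : Set (Set (List ℕ)) :=
  {T | IsTree T ∧ ∃ y, IsInfiniteBranch T y}

/-! ### The subshift -/

/-- The one-sided full shift space on the symbols `0, 1, 2, 3, 4`, with the product topology of
the discrete topologies. -/
abbrev FullShift : Type := ℕ → Fin 5

/-- The shift map `(σ z)_i = z_(i + 1)`. -/
def shift (z : FullShift) : FullShift :=
  SymbolicDynamics.FullShift.shift (1 : ℕ) z

theorem shift_apply (z : FullShift) (i : ℕ) : shift z i = z (i + 1) :=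
  congrArg z (Nat.add_comm 1 i)

/-- A one-sided subshift: a closed set mapped into itself by the shift. -/
def IsSubshift (X : Set FullShift) : Prop :=
  IsClosed X ∧ MapsTo shift X X

open Classical in
/-- The characteristic sequence `h(T)` of a set `T` of words, relative to the enumeration `e` of
all words, as a sequence of symbols `0` and `1` of the full shift. -/
noncomputable def charSeq (e : ℕ ≃ List ℕ) (T : Set (List ℕ)) : FullShift :=
  fun i => if e i ∈ T then 1 else 0

/-- The points `ω_n(T, y)`: `ω_0 = 3 4 0^∞` and
`ω_n = 3 (h(T)|n) 2^(n + y_(n-1)) ω_(n-1)` for `n ≥ 1`. -/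
noncomputable def omegaSeq (e : ℕ ≃ List ℕ) (T : Set (List ℕ)) (y : ℕ → ℕ) : ℕ → FullShift
  | 0 => conc [3, 4] (fun _ => 0)
  | n + 1 => conc [3] (conc (initSeg (charSeq e T) (n + 1))
      (conc (List.replicate (n + 1 + y n) 2) (omegaSeq e T y n)))

/-- The subshift `X`: all sequences in the symbols `0, 1, 2, 3`, and all the points
`σ^j (ω_i(T, y))` with `y` an infinite branch of the tree `T`. -/
def codingShift (e : ℕ ≃ List ℕ) : Set FullShift :=
  {z | ∀ k, z k ∈ ({0, 1, 2, 3} : Set (Fin 5))} ∪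
    {z | ∃ T y, (T, y) ∈ branchPairs ∧ ∃ i j : ℕ, z = shift^[j] (omegaSeq e T y i)}

theorem mapsTo_shift_codingShift (e : ℕ ≃ List ℕ) :
    MapsTo shift (codingShift e) (codingShift e) := by
  rintro z (hz | ⟨T, y, hTy, i, j, rfl⟩)
  · exact Or.inl fun k => hz (1 + k)
  · exact Or.inr ⟨T, y, hTy, i, j + 1, (Function.iterate_succ_apply' _ _ _).symm⟩

theorem omegaZero_mem (e : ℕ ≃ List ℕ) :
    (conc [3, 4] (fun _ => 0) : FullShift) ∈ codingShift e :=
  Or.inr ⟨univ, fun _ => 0, ⟨(isTree_iff _).2 fun _ _ _ _ => mem_univ _, fun _ => mem_univ _⟩, 0, 0, rfl⟩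

/-- The restriction `σ|_X : X → X` of the shift map. -/
def codingShiftMap (e : ℕ ≃ List ℕ) : codingShift e → codingShift e :=
  (mapsTo_shift_codingShift e).restrict

/-- The point `ω_0 = 3 4 0^∞` of `X`. -/
def omegaZero (e : ℕ ≃ List ℕ) : codingShift e :=
  ⟨conc [3, 4] (fun _ => 0), omegaZero_mem e⟩

end SpecialAlpha

/-!
The points `ω_n(T, y)` converge to `3 h(T)`, and a power of the shift maps `ω_(n+1)(T, y)` to
`ω_n(T, y)`; so a backward orbit of `ω_0` runs through all of them, and `3 h(T)` is a special
`α`-limit point whenever `T` has an infinite branch. Conversely, every point of a backward orbit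
of `ω_0` contains a `4`, and the symbol `3` marks the beginnings of the words `ω_k` in the points
containing a `4`. The points of the orbit near `3 h(T)` are thus of the form `ω_k(S, x)`, with `k`
large and `S` close to `T`. The lengths of the blocks of `2`s record the first `k` entries of `x`,
and these agree along the orbit, so the `x` converge to a sequence `y`. The relation that `y` is an
infinite branch of the tree `T` is closed, whence `T` is ill-founded.

The special `α`-limit set is analytic as a projection of a Borel set, since being a cluster point
of a backward orbit is a Borel condition. The set of ill-founded trees is not Borel: analytic
sets of sequences are projections of closed sets, a closed set is given by a set of pairs of words,
which has a code `χ`, and the section at `χ` of the set coded by `χ` is the set of branches of a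
tree depending continuously on `χ`. If the set of `χ` with well-founded tree were analytic, its own
code would contradict this.
-/

namespace SpecialAlpha

section Words

variable {A : Type*}

theorem conc_of_lt (l : List A) (z : ℕ → A) {i : ℕ} (h : i < l.length) : conc l z i = l[i] :=
  dif_pos h

theorem conc_length_add (l : List A) (z : ℕ → A) (i : ℕ) : conc l z (l.length + i) = z i := by
  simp [conc]

theorem conc_append (l l' : List A) (z : ℕ → A) : conc (l ++ l') z = conc l (conc l' z) := by
  ext i
  rcases lt_or_ge i l.length with hi | hi
  · rw [conc_of_lt _ _ (by simp; omega), conc_of_lt _ _ hi, List.getElem_append_left hi]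
  obtain ⟨i, rfl⟩ := Nat.exists_eq_add_of_le hi
  rw [conc_length_add]
  rcases lt_or_ge i l'.length with hi' | hi'
  · rw [conc_of_lt _ _ (by simpa using hi'), conc_of_lt _ _ hi', List.getElem_append_right hi]
    simp
  · obtain ⟨i, rfl⟩ := Nat.exists_eq_add_of_le hi'
    rw [conc_length_add, ← add_assoc, ← List.length_append, conc_length_add]

@[simp]
theorem length_initSeg (z : ℕ → A) (n : ℕ) : (initSeg z n).length = n := by
  simp [initSeg]

theorem getElem_initSeg (z : ℕ → A) {n i : ℕ} (h : i < (initSeg z n).length) :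
    (initSeg z n)[i] = z i := by
  simp [initSeg]

theorem initSeg_eq_iff {z w : ℕ → A} {n : ℕ} : initSeg z n = initSeg w n ↔ ∀ i < n, z i = w i := by
  simp [initSeg]

theorem take_initSeg (z : ℕ → A) {k n : ℕ} (h : k ≤ n) : (initSeg z n).take k = initSeg z k := by
  simp [initSeg, ← List.map_take, min_eq_left h]

theorem isLocallyConstant_initSeg [TopologicalSpace A] [DiscreteTopology A] (n : ℕ) :
    IsLocallyConstant fun z : ℕ → A => initSeg z n :=
  (IsLocallyConstant.iff_eventually_eq _).2 fun z =>
    Filter.mem_of_superset ((PiNat.isOpen_cylinder _ z n).mem_nhds (PiNat.self_mem_cylinder z n))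
      fun _ => initSeg_eq_iff.2

theorem tendsto_of_forall_eventually_eq [TopologicalSpace A] {ι κ : Type*} {l : Filter ι}
    {u : ι → κ → A} {z : κ → A} (h : ∀ k, ∀ᶠ n in l, u n k = z k) : Tendsto u l (𝓝 z) :=
  tendsto_pi_nhds.2 fun k => tendsto_nhds_of_eventually_eq (h k)

end Words

section SpecialAlphaLimit

variable {Y : Type*} {f : Y → Y}

theorem IsBackwardOrbit.iterate_eq {x : Y} {u : ℕ → Y} (hu : IsBackwardOrbit f x u) (m k : ℕ) :
    f^[k] (u (m + k)) = u m := by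
  induction k with
  | zero => rfl
  | succ k ih => rw [Function.iterate_succ_apply, ← add_assoc, hu.2, ih]

theorem exists_isBackwardOrbit_of_iterate_eq {w : ℕ → Y} {b : ℕ → ℕ} (hb : ∀ n, 0 < b n)
    (hw : ∀ n, f^[b n] (w (n + 1)) = w n) :
    ∃ u, IsBackwardOrbit f (w 0) u ∧ ∃ φ : ℕ → ℕ, StrictMono φ ∧ ∀ n, u (φ n) = w n := by
  let L : ℕ → ℕ := fun n => ∑ i ∈ Finset.range n, b i
  have hL_succ : ∀ n, L (n + 1) = L n + b n := fun n => Finset.sum_range_succ _ _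
  have hL : StrictMono L := strictMono_nat_of_lt_succ fun n => by have := hb n; grind
  have hL_iterate : ∀ {n m}, n ≤ m → f^[L m - L n] (w m) = w n := fun {n m} h => by
    induction m, h using Nat.le_induction with
    | base => simp
    | succ m h ih =>
      have := hL.monotone h
      rw [show L (m + 1) - L n = (L m - L n) + b m by grind, Function.iterate_add_apply, hw, ih]
  refine ⟨fun k => f^[L k - k] (w k), ⟨rfl, fun k => ?_⟩, L, hL, fun n => hL_iterate hL.le_apply⟩
  have h₁ : k ≤ L k := hL.le_apply
  have h₂ : k + 1 ≤ L (k + 1) := hL.le_apply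
  rw [← Function.iterate_succ_apply' f,
    show (L (k + 1) - (k + 1)).succ = (L k - k) + b k by grind, Function.iterate_add_apply, hw]

variable [TopologicalSpace Y]

theorem mem_specialAlphaLimit_iff {x z : Y} :
    z ∈ specialAlphaLimit f x ↔ ∃ u, IsBackwardOrbit f x u ∧ MapClusterPt z atTop u := by
  simp [specialAlphaLimit]

theorem mem_specialAlphaLimit_of_tendsto {w : ℕ → Y} {b : ℕ → ℕ} {z : Y} (hb : ∀ n, 0 < b n)
    (hw : ∀ n, f^[b n] (w (n + 1)) = w n) (hz : Tendsto w atTop (𝓝 z)) :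
    z ∈ specialAlphaLimit f (w 0) := by
  obtain ⟨u, hu, φ, hφ, huφ⟩ := exists_isBackwardOrbit_of_iterate_eq hb hw
  have huz : Tendsto (u ∘ φ) atTop (𝓝 z) := by rwa [show u ∘ φ = w from funext huφ]
  exact mem_specialAlphaLimit_iff.2 ⟨u, hu, .of_comp hφ.tendsto_atTop huz.mapClusterPt⟩

theorem measurableSet_setOf_mapClusterPt [SecondCountableTopology Y] [MeasurableSpace Y]
    [OpensMeasurableSpace Y] : MeasurableSet {p : (ℕ → Y) × Y | MapClusterPt p.2 atTop p.1} := by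
  obtain ⟨b, hb_countable, -, hb⟩ := TopologicalSpace.exists_countable_basis Y
  have h_eq : {p : (ℕ → Y) × Y | MapClusterPt p.2 atTop p.1} =
      ⋂ s ∈ b, ⋂ n, ({p | p.2 ∉ s} ∪ ⋃ m ≥ n, {p | p.1 m ∈ s}) := by
    ext ⟨u, z⟩
    simp only [hb.nhds_hasBasis.mapClusterPt_iff_frequently, frequently_atTop, mem_ofPred_eq,
      mem_iInter, mem_union, mem_iUnion, exists_prop]
    exact ⟨fun h s hs n => or_iff_not_imp_left.2 fun hz => h s ⟨hs, not_not.1 hz⟩ n,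
      fun h s hs n => (h s hs.1 n).resolve_left (not_not.2 hs.2)⟩
  rw [h_eq]
  refine .biInter hb_countable fun s hs => .iInter fun n => ?_
  have hs := (hb.isOpen hs).measurableSet
  exact (measurable_snd hs).compl.union <| .iUnion fun m => .iUnion fun _ =>
    ((measurable_pi_apply m).comp measurable_fst) hs

theorem analyticSet_specialAlphaLimit [PolishSpace Y] [MeasurableSpace Y] [BorelSpace Y]
    (hf : Measurable f) (x : Y) : AnalyticSet (specialAlphaLimit f x) := by
  have h_eq : specialAlphaLimit f x = Prod.snd ''
      ({p : (ℕ → Y) × Y | IsBackwardOrbit f x p.1} ∩ {p | MapClusterPt p.2 atTop p.1}) := by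
    ext z
    simp [mem_specialAlphaLimit_iff]
  have h_orbit : MeasurableSet {p : (ℕ → Y) × Y | IsBackwardOrbit f x p.1} := by
    simp only [IsBackwardOrbit, ofPred_and, ofPred_forall]
    exact (measurableSet_eq_fun (by fun_prop) (by fun_prop)).inter <|
      .iInter fun n => measurableSet_eq_fun (by fun_prop) (by fun_prop)
  rw [h_eq]
  exact (h_orbit.inter measurableSet_setOf_mapClusterPt).analyticSet.image_of_continuous
    continuous_snd

end SpecialAlphaLimit

section IllFounded

attribute [local instance] powerTopology

theorem isClopen_setOf_mem (s : List ℕ) : IsClopen {T : Set (List ℕ) | s ∈ T} :=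
  ⟨⟨TopologicalSpace.isOpen_generateFrom_of_mem (Or.inr ⟨s, rfl⟩)⟩,
    TopologicalSpace.isOpen_generateFrom_of_mem (Or.inl ⟨s, rfl⟩)⟩

theorem continuous_powerSet_of_isClopen {Z : Type*} [TopologicalSpace Z] {F : Z → Set (List ℕ)}
    (hF : ∀ s, IsClopen {z | s ∈ F z}) : Continuous F := by
  refine continuous_generateFrom_iff.2 ?_
  rintro _ (⟨s, rfl⟩ | ⟨s, rfl⟩)
  exacts [(hF s).isOpen, (hF s).compl.isOpen]

theorem mem_branchPairs_of_eventually {ι : Type*} {l : Filter ι} [l.NeBot]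
    {S : ι → Set (List ℕ)} {x : ι → ℕ → ℕ} {T : Set (List ℕ)} {y : ℕ → ℕ}
    (h : ∀ᶠ n in l, (S n, x n) ∈ branchPairs) (hS : ∀ s, ∀ᶠ n in l, s ∈ S n ↔ s ∈ T)
    (hx : ∀ i, ∀ᶠ n in l, x n i = y i) : (T, y) ∈ branchPairs := by
  refine ⟨(isTree_iff T).2 fun t ht s hst => ?_, fun k => ?_⟩
  · obtain ⟨n, hn, hs, ht'⟩ := (h.and ((hS s).and (hS t))).exists
    exact hs.1 ((isTree_iff _).1 hn.1 t (ht'.2 ht) s hst)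
  · have hxk : ∀ᶠ n in l, initSeg (x n) k = initSeg y k := by
      simpa [initSeg_eq_iff] using (Finset.range k).eventually_all.2 fun i _ => hx i
    obtain ⟨n, hn, hs, hxn⟩ := (h.and ((hS (initSeg y k)).and hxk)).exists
    exact hs.1 (hxn ▸ hn.2 k)

theorem exists_forall_initSeg_mem_iff_of_analyticSet {A : Type*} [TopologicalSpace A] [T2Space A]
    {D : Set (ℕ → A)} (hD : AnalyticSet D) :
    ∃ C : Set (List A × List ℕ), ∀ z, z ∈ D ↔ ∃ y : ℕ → ℕ, ∀ n, (initSeg z n, initSeg y n) ∈ C := by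
  obtain rfl | ⟨g, hg, rfl⟩ := by rwa [AnalyticSet] at hD
  · exact ⟨∅, by simp⟩
  refine ⟨{p | ∃ x n, p = (initSeg (g x) n, initSeg x n)}, fun z => ⟨?_, ?_⟩⟩
  · rintro ⟨y, rfl⟩
    exact ⟨y, fun n => ⟨y, n, rfl⟩⟩
  rintro ⟨y, hy⟩
  choose x m hx using hy
  have hm : ∀ n, m n = n := fun n => by
    simpa using (congrArg (fun p => p.2.length) (hx n)).symm
  simp only [hm, Prod.mk.injEq, initSeg_eq_iff] at hx
  have hxy : Tendsto x atTop (𝓝 y) := tendsto_of_forall_eventually_eq fun i =>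
    (eventually_gt_atTop i).mono fun n hn => ((hx n).2 i hn).symm
  have hgz : Tendsto (g ∘ x) atTop (𝓝 z) := tendsto_of_forall_eventually_eq fun i =>
    (eventually_gt_atTop i).mono fun n hn => ((hx n).1 i hn).symm
  exact ⟨y, tendsto_nhds_unique ((hg.tendsto y).comp hxy) hgz⟩

/-- The section at `χ` of the closed set coded by `χ`, as a tree: reading `χ` as the characteristic
function of a set `C` of pairs of words, the infinite branches of `diagonalTree χ` are the `y` with
`(χ|n, y|n) ∈ C` for all `n`. It serves to diagonalize against all analytic sets. -/
def diagonalTree (χ : ℕ → Bool) : Set (List ℕ) :=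
  {s | ∀ k ≤ s.length, χ (Encodable.encode (initSeg χ k, s.take k)) = true}

theorem isTree_diagonalTree (χ : ℕ → Bool) : IsTree (diagonalTree χ) := by
  rw [isTree_iff]
  intro t ht s hst k hk
  have := ht k (hk.trans hst.length_le)
  rwa [List.prefix_iff_eq_take.1 hst, List.take_take, min_eq_left hk]

theorem isInfiniteBranch_diagonalTree_iff {χ : ℕ → Bool} {y : ℕ → ℕ} :
    IsInfiniteBranch (diagonalTree χ) y ↔
      ∀ n, χ (Encodable.encode (initSeg χ n, initSeg y n)) = true := by
  refine ⟨fun h n => ?_, fun h n k hk => ?_⟩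
  · simpa [take_initSeg] using h n n (length_initSeg y n).ge
  · rw [length_initSeg] at hk
    rw [take_initSeg y hk]
    exact h k

theorem diagonalTree_mem_illFounded_iff {χ : ℕ → Bool} :
    diagonalTree χ ∈ illFounded ↔
      ∃ y : ℕ → ℕ, ∀ n, χ (Encodable.encode (initSeg χ n, initSeg y n)) = true := by
  simp [illFounded, isTree_diagonalTree, isInfiniteBranch_diagonalTree_iff]

theorem continuous_diagonalTree : Continuous diagonalTree := by
  refine continuous_powerSet_of_isClopen fun s => ?_
  have h_eq : {χ | s ∈ diagonalTree χ} = ⋂ k ∈ Iic s.length,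
      {χ : ℕ → Bool | χ (Encodable.encode (initSeg χ k, s.take k)) = true} := by
    ext
    simp [diagonalTree]
  rw [h_eq]
  refine (finite_Iic _).isClopen_biInter fun k _ => ?_
  have h_cont : Continuous fun χ : ℕ → Bool => χ (Encodable.encode (initSeg χ k, s.take k)) :=
    continuous_iff_continuousAt.2 fun χ =>
      (continuous_apply (Encodable.encode (initSeg χ k, s.take k))).continuousAt.congr <|
        ((isLocallyConstant_initSeg k).eventually_eq χ).mono fun _ h => by simp only [h]
  exact (isClopen_discrete {true}).preimage h_cont

theorem not_analyticSet_diagonalTree_notMem_illFounded :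
    ¬ AnalyticSet {χ | diagonalTree χ ∉ illFounded} := by
  classical
  intro hD
  obtain ⟨C, hC⟩ := exists_forall_initSeg_mem_iff_of_analyticSet hD
  let c : ℕ → Bool := fun i => decide (∃ p ∈ C, Encodable.encode p = i)
  have hc : ∀ p, c (Encodable.encode p) = true ↔ p ∈ C := by simp [c]
  have h_diag : diagonalTree c ∉ illFounded ↔ diagonalTree c ∈ illFounded := by
    simpa only [mem_ofPred_eq, diagonalTree_mem_illFounded_iff, hc] using hC c
  exact not_iff_self h_diag

theorem not_measurableSet_illFounded : ¬ MeasurableSet[borel (Set (List ℕ))] illFounded := by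
  intro h
  have : PolishSpace (ℕ → Bool) := .mk
  have h_meas : MeasurableSet {χ | diagonalTree χ ∉ illFounded} := by
    rw [BorelSpace.measurable_eq (α := ℕ → Bool)]
    exact (continuous_diagonalTree.borel_measurable h).compl
  exact not_analyticSet_diagonalTree_notMem_illFounded h_meas.analyticSet

end IllFounded

theorem iterate_shift_apply (j : ℕ) (z : FullShift) (i : ℕ) : shift^[j] z i = z (i + j) := by
  induction j generalizing z with
  | zero => rfl
  | succ j ih => rw [Function.iterate_succ_apply, ih, shift_apply, add_assoc]

theorem iterate_shift_conc (l : List (Fin 5)) (z : FullShift) :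
    shift^[l.length] (conc l z) = z := by
  ext i
  rw [iterate_shift_apply, add_comm, conc_length_add]

theorem continuous_shift : Continuous shift :=
  continuous_pi fun i => continuous_apply (A := fun _ => Fin 5) (1 + i)

section Omega

variable (e : ℕ ≃ List ℕ) (T : Set (List ℕ)) (y : ℕ → ℕ)

theorem charSeq_le_one (i : ℕ) : charSeq e T i ≤ 1 := by
  unfold charSeq
  split_ifs <;> decide

theorem charSeq_eq_iff {T' : Set (List ℕ)} {i : ℕ} :
    charSeq e T i = charSeq e T' i ↔ (e i ∈ T ↔ e i ∈ T') := by
  unfold charSeq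
  split_ifs <;> simp_all

/-- The word `3 (h(T)|(n+1)) 2^(n+1+y_n)` by which `ω_(n+1)` extends `ω_n` to the left. -/
noncomputable def omegaBlock (n : ℕ) : List (Fin 5) :=
  3 :: (initSeg (charSeq e T) (n + 1) ++ List.replicate (n + 1 + y n) 2)

theorem length_omegaBlock (n : ℕ) : (omegaBlock e T y n).length = 2 * n + y n + 3 := by
  simp [omegaBlock]
  omega

theorem omegaSeq_succ (n : ℕ) :
    omegaSeq e T y (n + 1) = conc (omegaBlock e T y n) (omegaSeq e T y n) := by
  rw [omegaSeq, ← conc_append, ← conc_append]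
  rfl

theorem omegaSeq_succ_length_add (n i : ℕ) :
    omegaSeq e T y (n + 1) ((omegaBlock e T y n).length + i) = omegaSeq e T y n i := by
  rw [omegaSeq_succ, conc_length_add]

theorem iterate_shift_omegaSeq_succ (n : ℕ) :
    shift^[(omegaBlock e T y n).length] (omegaSeq e T y (n + 1)) = omegaSeq e T y n := by
  rw [omegaSeq_succ, iterate_shift_conc]

theorem omegaSeq_apply_zero (n : ℕ) : omegaSeq e T y n 0 = 3 := by
  cases n <;> rfl

theorem omegaSeq_apply_succ {n i : ℕ} (h : i < n) : omegaSeq e T y n (i + 1) = charSeq e T i := by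
  obtain ⟨n, rfl⟩ := Nat.exists_eq_add_one_of_ne_zero h.ne_bot
  change conc (initSeg (charSeq e T) (n + 1)) _ i = _
  rw [conc_of_lt _ _ (by simpa using h), getElem_initSeg]

theorem one_lt_omegaSeq_apply_succ (n : ℕ) : 1 < omegaSeq e T y n (n + 1) := by
  cases n with
  | zero => change (1 : Fin 5) < 4; decide
  | succ n =>
    have h : omegaSeq e T y (n + 1) (n + 1 + 1) = 2 := by
      have h_add := conc_length_add (initSeg (charSeq e T) (n + 1))
        (conc (List.replicate (n + 1 + y n) 2) (omegaSeq e T y n)) 0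
      rw [length_initSeg, add_zero] at h_add
      refine h_add.trans ?_
      rw [conc_of_lt _ _ (by simp), List.getElem_replicate]
    rw [h]
    decide

theorem forall_lt_omegaSeq_apply_succ_le_one_iff {n m : ℕ} :
    (∀ i < m, omegaSeq e T y n (i + 1) ≤ 1) ↔ m ≤ n := by
  refine ⟨fun h => ?_, fun h i hi => ?_⟩
  · by_contra! hnm
    exact (one_lt_omegaSeq_apply_succ e T y n).not_ge (h n hnm)
  · rw [omegaSeq_apply_succ e T y (hi.trans_le h)]
    exact charSeq_le_one e T i

theorem omegaSeq_succ_apply_lt_three {n i : ℕ} (hi : 0 < i)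
    (h : i < (omegaBlock e T y n).length) : omegaSeq e T y (n + 1) i < 3 := by
  obtain ⟨i, rfl⟩ := Nat.exists_eq_add_one_of_ne_zero hi.ne'
  have h_lt : ∀ a ∈ initSeg (charSeq e T) (n + 1) ++ List.replicate (n + 1 + y n) 2, a < 3 := by
    intro a ha
    rcases List.mem_append.1 ha with ha | ha
    · obtain ⟨k, -, rfl⟩ := List.mem_map.1 ha
      exact (charSeq_le_one e T k).trans_lt (by decide)
    · rw [List.eq_of_mem_replicate ha]
      decide
  rw [omegaSeq_succ, conc_of_lt _ _ h]
  exact h_lt _ (List.getElem_mem _)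

theorem iterate_shift_omegaSeq_cases (n j : ℕ) :
    (∃ m, shift^[j] (omegaSeq e T y n) = omegaSeq e T y m) ∨ omegaSeq e T y n j < 3 ∨
      shift^[j] (omegaSeq e T y n) = conc [4] fun _ => 0 := by
  induction n generalizing j with
  | zero =>
    have h_tail : shift^[1] (omegaSeq e T y 0) = conc [4] fun _ => 0 := by
      rw [omegaSeq, ← List.singleton_append, conc_append]
      exact iterate_shift_conc [3] _
    match j with
    | 0 => exact Or.inl ⟨0, rfl⟩
    | 1 => exact Or.inr (Or.inr h_tail)
    | j + 2 => exact Or.inr (Or.inl (by change (0 : Fin 5) < 3; decide))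
  | succ n ih =>
    rcases lt_or_ge j (omegaBlock e T y n).length with hj | hj
    · rcases j.eq_zero_or_pos with rfl | hj_pos
      · exact Or.inl ⟨n + 1, rfl⟩
      · exact Or.inr (Or.inl (omegaSeq_succ_apply_lt_three e T y hj_pos hj))
    · obtain ⟨j, rfl⟩ := Nat.exists_eq_add_of_le' hj
      rw [Function.iterate_add_apply, iterate_shift_omegaSeq_succ, add_comm j,
        omegaSeq_succ_length_add]
      exact ih j

variable {e T y}

theorem exists_iterate_shift_omegaSeq_eq_of_eq_three {n j : ℕ} (h : omegaSeq e T y n j = 3) :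
    ∃ m, shift^[j] (omegaSeq e T y n) = omegaSeq e T y m := by
  rcases iterate_shift_omegaSeq_cases e T y n j with hm | h_lt | h_four
  · exact hm
  · exact absurd h h_lt.ne
  · have h_eq := congrFun h_four 0
    rw [iterate_shift_apply, zero_add, h] at h_eq
    exact absurd h_eq (by decide : (3 : Fin 5) ≠ 4)

theorem iterate_shift_omegaSeq_of_eq_four {n j : ℕ} (h : omegaSeq e T y n j = 4) :
    shift^[j] (omegaSeq e T y n) = conc [4] fun _ => 0 := by
  rcases iterate_shift_omegaSeq_cases e T y n j with ⟨m, hm⟩ | h_lt | h_four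
  · have h_eq := congrFun hm 0
    rw [iterate_shift_apply, zero_add, h, omegaSeq_apply_zero] at h_eq
    exact absurd h_eq (by decide)
  · rw [h] at h_lt
    exact absurd h_lt (by decide)
  · exact h_four

theorem length_omegaBlock_le_of_omegaSeq_eq {T' : Set (List ℕ)} {y' : ℕ → ℕ} {n : ℕ}
    (h : omegaSeq e T y (n + 1) = omegaSeq e T' y' (n + 1)) :
    (omegaBlock e T y n).length ≤ (omegaBlock e T' y' n).length := by
  by_contra! h_lt
  have h_pos : 0 < (omegaBlock e T' y' n).length := by simp [length_omegaBlock]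
  have h_three := omegaSeq_succ_length_add e T' y' n 0
  rw [add_zero, omegaSeq_apply_zero, ← h] at h_three
  exact (omegaSeq_succ_apply_lt_three e T y h_pos h_lt).ne h_three

theorem eq_and_forall_lt_eq_of_omegaSeq_eq {T' : Set (List ℕ)} {y' : ℕ → ℕ} {n n' : ℕ}
    (h : omegaSeq e T y n = omegaSeq e T' y' n') : n = n' ∧ ∀ i < n, y i = y' i := by
  obtain rfl : n = n' := eq_of_forall_le_iff fun m => by
    rw [← forall_lt_omegaSeq_apply_succ_le_one_iff e T y, h,
      forall_lt_omegaSeq_apply_succ_le_one_iff]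
  refine ⟨rfl, ?_⟩
  induction n with
  | zero => simp
  | succ n ih =>
    have h_length := (length_omegaBlock_le_of_omegaSeq_eq h).antisymm
      (length_omegaBlock_le_of_omegaSeq_eq h.symm)
    have h_tail : omegaSeq e T y n = omegaSeq e T' y' n := by
      rw [← iterate_shift_omegaSeq_succ, h_length, h, iterate_shift_omegaSeq_succ]
    have hn : y n = y' n := by
      simpa only [length_omegaBlock, Nat.add_right_cancel_iff, Nat.add_left_cancel_iff]
        using h_length
    exact Nat.forall_lt_succ_right.2 ⟨ih h_tail, hn⟩

variable (e T y)

theorem tendsto_omegaSeq : Tendsto (omegaSeq e T y) atTop (𝓝 (conc [3] (charSeq e T))) :=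
  tendsto_of_forall_eventually_eq fun
    | 0 => .of_forall fun n => omegaSeq_apply_zero e T y n
    | i + 1 => (eventually_gt_atTop i).mono fun _ hn => omegaSeq_apply_succ e T y hn

end Omega

section CodingShift

variable {e : ℕ ≃ List ℕ}

theorem mem_codingShift_iff {z : FullShift} :
    z ∈ codingShift e ↔ (∀ k, z k ≠ 4) ∨
      ∃ T y, (T, y) ∈ branchPairs ∧ ∃ i j : ℕ, z = shift^[j] (omegaSeq e T y i) := by
  have h : ∀ a : Fin 5, a ∈ ({0, 1, 2, 3} : Set (Fin 5)) ↔ a ≠ 4 := by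
    simp only [mem_insert_iff, mem_singleton_iff]
    decide
  simp only [codingShift, mem_union, mem_ofPred_eq, h]

theorem omegaSeq_mem_codingShift {T : Set (List ℕ)} {y : ℕ → ℕ} (h : (T, y) ∈ branchPairs)
    (n : ℕ) : omegaSeq e T y n ∈ codingShift e :=
  Or.inr ⟨T, y, h, n, 0, rfl⟩

theorem eq_zero_of_eq_four_of_lt {z : FullShift} (hz : z ∈ codingShift e) {p q : ℕ} (hp : z p = 4)
    (hpq : p < q) : z q = 0 := by
  rcases mem_codingShift_iff.1 hz with hz | ⟨T, y, -, i, j, rfl⟩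
  · exact absurd hp (hz p)
  rw [iterate_shift_apply] at hp ⊢
  obtain ⟨r, rfl⟩ := Nat.exists_eq_add_of_lt hpq
  have h_eq := congrFun (iterate_shift_omegaSeq_of_eq_four hp) (r + 1)
  rwa [iterate_shift_apply, show r + 1 + (p + j) = p + r + 1 + j by ring] at h_eq

theorem exists_eq_omegaSeq_of_mem_codingShift {z : FullShift} (hz : z ∈ codingShift e)
    (h0 : z 0 = 3) {p : ℕ} (hp : z p = 4) :
    ∃ T y, (T, y) ∈ branchPairs ∧ ∃ n, z = omegaSeq e T y n := by
  rcases mem_codingShift_iff.1 hz with hz | ⟨T, y, hTy, i, j, rfl⟩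
  · exact absurd hp (hz p)
  rw [iterate_shift_apply, zero_add] at h0
  exact ⟨T, y, hTy, exists_iterate_shift_omegaSeq_eq_of_eq_three h0⟩

variable (e)

theorem isClosed_codingShift : IsClosed (codingShift e) := by
  refine isClosed_of_closure_subset fun z hz => ?_
  by_cases h : ∀ k, z k ≠ 4
  · exact mem_codingShift_iff.2 (Or.inl h)
  push Not at h
  obtain ⟨p, hp⟩ := h
  let U : Set FullShift := PiNat.cylinder z (p + 1)
  have hU : (U ∩ codingShift e).Subsingleton := by
    have h_four : ∀ w ∈ U, w p = 4 := fun w hw => (hw p p.lt_succ_self).trans hp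
    rintro w ⟨hwU, hw⟩ w' ⟨hwU', hw'⟩
    ext1 q
    rcases lt_or_ge p q with hq | hq
    · rw [eq_zero_of_eq_four_of_lt hw (h_four w hwU) hq,
        eq_zero_of_eq_four_of_lt hw' (h_four w' hwU') hq]
    · rw [hwU q (Nat.lt_succ_of_le hq), hwU' q (Nat.lt_succ_of_le hq)]
  have hz_closure : z ∈ closure (U ∩ codingShift e) :=
    (PiNat.isOpen_cylinder _ z (p + 1)).inter_closure ⟨PiNat.self_mem_cylinder z (p + 1), hz⟩
  rw [hU.isClosed.closure_eq] at hz_closure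
  exact hz_closure.2

theorem image_shift_codingShift : shift '' codingShift e = codingShift e := by
  refine (mapsTo_shift_codingShift e).image_subset.antisymm fun z hz => ?_
  rcases mem_codingShift_iff.1 hz with hz | ⟨T, y, hTy, i, j, rfl⟩
  · refine ⟨conc [0] z, mem_codingShift_iff.2 (Or.inl fun
      | 0 => (by decide : (0 : Fin 5) ≠ 4)
      | k + 1 => hz k), iterate_shift_conc [0] z⟩
  · refine ⟨shift^[j + (2 * i + y i + 2)] (omegaSeq e T y (i + 1)),
      Or.inr ⟨T, y, hTy, _, _, rfl⟩, ?_⟩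
    rw [← Function.iterate_succ_apply' shift, ← iterate_shift_omegaSeq_succ e T y i,
      length_omegaBlock, ← Function.iterate_add_apply]
    rfl

theorem continuous_codingShiftMap : Continuous (codingShiftMap e) :=
  continuous_shift.restrict (mapsTo_shift_codingShift e)

/-- The reduction `f(T) = 3 h(T)` of the ill-founded trees to the special `α`-limit set. -/
noncomputable def treePoint (T : Set (List ℕ)) : codingShift e :=
  ⟨conc [3] (charSeq e T), mem_codingShift_iff.2 <| Or.inl fun
    | 0 => (by decide : (3 : Fin 5) ≠ 4)
    | k + 1 => ((charSeq_le_one e T k).trans_lt (by decide)).ne⟩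

theorem continuous_treePoint :
    Continuous[powerTopology, instTopologicalSpaceSubtype] (treePoint e) := by
  classical
  let := powerTopology
  refine Continuous.subtype_mk (continuous_pi fun
    | 0 => continuous_const
    | i + 1 => ?_) _
  change Continuous fun T => if e i ∈ T then (1 : Fin 5) else 0
  refine Continuous.if (fun T hT => ?_) continuous_const continuous_const
  rw [(isClopen_setOf_mem (e i)).frontier_eq] at hT
  exact hT.elim

variable {e}

theorem treePoint_mem_specialAlphaLimit {T : Set (List ℕ)} {y : ℕ → ℕ}
    (h : (T, y) ∈ branchPairs) :
    treePoint e T ∈ specialAlphaLimit (codingShiftMap e) (omegaZero e) := by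
  let w : ℕ → codingShift e := fun n => ⟨omegaSeq e T y n, omegaSeq_mem_codingShift h n⟩
  refine mem_specialAlphaLimit_of_tendsto (w := w) (b := fun n => (omegaBlock e T y n).length)
    (fun n => by simp [length_omegaBlock]) (fun n => Subtype.ext ?_)
    (tendsto_subtype_rng.2 (tendsto_omegaSeq e T y))
  rw [codingShiftMap, MapsTo.coe_iterate_restrict]
  exact iterate_shift_omegaSeq_succ e T y n

theorem exists_omegaSeq_of_mapClusterPt {u : ℕ → codingShift e} {T : Set (List ℕ)}
    (hu : IsBackwardOrbit (codingShiftMap e) (omegaZero e) u)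
    (hT : MapClusterPt (treePoint e T) atTop u) (n : ℕ) :
    ∃ m k S x, (S, x) ∈ branchPairs ∧ (u m : FullShift) = omegaSeq e S x k ∧ n ≤ k ∧
      ∀ i < n, e i ∈ S ↔ e i ∈ T := by
  have h_nhds : Subtype.val ⁻¹' PiNat.cylinder (treePoint e T : FullShift) (n + 1) ∈
      𝓝 (treePoint e T) :=
    ((PiNat.isOpen_cylinder _ _ _).preimage continuous_subtype_val).mem_nhds
      (PiNat.self_mem_cylinder _ _)
  obtain ⟨m, hm⟩ := (hT.frequently h_nhds).exists
  have h_four : (u m : FullShift) (1 + m) = 4 := by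
    have h_iterate := congrArg Subtype.val (hu.iterate_eq 0 m)
    rw [hu.1, zero_add, codingShiftMap, MapsTo.coe_iterate_restrict] at h_iterate
    rw [← iterate_shift_apply m (u m) 1, h_iterate]
    rfl
  obtain ⟨S, x, hSx, k, hk⟩ :=
    exists_eq_omegaSeq_of_mem_codingShift (u m).2 (hm 0 n.succ_pos) h_four
  rw [hk] at hm
  have h_char : ∀ i < n, omegaSeq e S x k (i + 1) = charSeq e T i := fun i hi =>
    hm (i + 1) (Nat.succ_lt_succ hi)
  have hnk : n ≤ k := (forall_lt_omegaSeq_apply_succ_le_one_iff e S x).1 fun i hi => by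
    rw [h_char i hi]
    exact charSeq_le_one e T i
  refine ⟨m, k, S, x, hSx, hk, hnk, fun i hi => (charSeq_eq_iff e S).1 ?_⟩
  rw [← h_char i hi, omegaSeq_apply_succ e S x (hi.trans_le hnk)]

theorem branch_eq_of_isBackwardOrbit {x₀ : codingShift e} {u : ℕ → codingShift e}
    (hu : IsBackwardOrbit (codingShiftMap e) x₀ u) {m m' k k' : ℕ} {S S' : Set (List ℕ)}
    {x x' : ℕ → ℕ} (h : (u m : FullShift) = omegaSeq e S x k)
    (h' : (u m' : FullShift) = omegaSeq e S' x' k') {i : ℕ} (hi : i < k) (hi' : i < k') :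
    x i = x' i := by
  wlog hm : m ≤ m' generalizing m m' k k' S S' x x'
  · exact (this h' h hi' hi (le_of_not_ge hm)).symm
  obtain ⟨d, rfl⟩ := Nat.exists_eq_add_of_le hm
  have h_iterate : shift^[d] (omegaSeq e S' x' k') = omegaSeq e S x k := by
    rw [← h, ← h', ← hu.iterate_eq m d, codingShiftMap, MapsTo.coe_iterate_restrict]
  have h_three : omegaSeq e S' x' k' d = 3 := by
    rw [← omegaSeq_apply_zero e S x k, ← h_iterate, iterate_shift_apply, zero_add]
  obtain ⟨j, hj⟩ := exists_iterate_shift_omegaSeq_eq_of_eq_three h_three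
  exact (eq_and_forall_lt_eq_of_omegaSeq_eq (h_iterate.symm.trans hj)).2 i hi

theorem mem_illFounded_of_treePoint_mem {T : Set (List ℕ)}
    (hT : treePoint e T ∈ specialAlphaLimit (codingShiftMap e) (omegaZero e)) :
    T ∈ illFounded := by
  obtain ⟨u, hu, hT⟩ := mem_specialAlphaLimit_iff.1 hT
  choose m k S x hSx hux hk hS using exists_omegaSeq_of_mapClusterPt hu hT
  have h_limit : (T, fun i => x (i + 1) i) ∈ branchPairs := by
    refine mem_branchPairs_of_eventually (l := atTop) (.of_forall hSx) (fun s => ?_) fun i => ?_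
    · obtain ⟨i, rfl⟩ := e.surjective s
      exact (eventually_gt_atTop i).mono fun n hn => hS n i hn
    · exact (eventually_gt_atTop i).mono fun n hn =>
        branch_eq_of_isBackwardOrbit hu (hux n) (hux (i + 1)) (hn.trans_le (hk n)) (hk (i + 1))
  exact ⟨h_limit.1, _, h_limit.2⟩

variable (e)

theorem preimage_treePoint :
    treePoint e ⁻¹' specialAlphaLimit (codingShiftMap e) (omegaZero e) = illFounded :=
  Subset.antisymm (fun _ hT => mem_illFounded_of_treePoint_mem hT)
    fun _ ⟨hT, _, hy⟩ => treePoint_mem_specialAlphaLimit ⟨hT, hy⟩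

theorem isSigmaOneOneComplete_specialAlphaLimit :
    IsSigmaOneOneComplete (specialAlphaLimit (codingShiftMap e) (omegaZero e)) := by
  have : PolishSpace FullShift := .mk
  have : PolishSpace (codingShift e) := (isClosed_codingShift e).polishSpace
  constructor
  · borelize ↥(codingShift e)
    exact analyticSet_specialAlphaLimit (continuous_codingShiftMap e).measurable _
  · intro h
    let := powerTopology
    have h_preimage := (continuous_treePoint e).borel_measurable h
    rw [preimage_treePoint] at h_preimage
    exact not_measurableSet_illFounded h_preimage

end CodingShift

end SpecialAlpha

theorem theorem3p3 (e : ℕ ≃ List ℕ) :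
    SpecialAlpha.IsSubshift (SpecialAlpha.codingShift e) ∧
    SpecialAlpha.shift '' SpecialAlpha.codingShift e = SpecialAlpha.codingShift e ∧
    SpecialAlpha.IsSigmaOneOneComplete
      (SpecialAlpha.specialAlphaLimit (SpecialAlpha.codingShiftMap e)
        (SpecialAlpha.omegaZero e)) ∧
    ∃ f : Set (List ℕ) → SpecialAlpha.codingShift e,
      (∀ T, (f T : SpecialAlpha.FullShift) =
        SpecialAlpha.conc [3] (SpecialAlpha.charSeq e T)) ∧
      Continuous[SpecialAlpha.powerTopology, instTopologicalSpaceSubtype] f ∧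
      f ⁻¹' SpecialAlpha.specialAlphaLimit (SpecialAlpha.codingShiftMap e)
        (SpecialAlpha.omegaZero e) = SpecialAlpha.illFounded :=
  ⟨⟨SpecialAlpha.isClosed_codingShift e, SpecialAlpha.mapsTo_shift_codingShift e⟩,
    SpecialAlpha.image_shift_codingShift e,
    SpecialAlpha.isSigmaOneOneComplete_specialAlphaLimit e,
    SpecialAlpha.treePoint e, fun _ => rfl, SpecialAlpha.continuous_treePoint e,
    SpecialAlpha.preimage_treePoint e⟩
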